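/- **Conventions.** A category $\mathbb C$ *has local products* if for all $f\colon A\to B$, $r\colon B\to A$, $g\colon C\to B$, $s\colon B\to C$ with $fr=1_B=gs$ the pullback $A\xleftarrow{\pi_1}A\times_BC\xrightarrow{\pi_2}C$ of $g$ along $f$ exists. Let $\mathbb C$ be such a category, with a fixed choice of the pullbacks used below. A *local product* is a diagram $p_1\colon E\to A$, $e_1\colon A\to E$, $p_2\colon E\to C$, $e_2\colon C\to E$ for which there are $f,r,g,s$ as above such that $(E,p_1,p_2)$ is a pullback of $g$ along $f$, $e_1=\langle 1_A,sf\rangle$ and $e_2=\langle rg,1_C\rangle$; its *span part* is $(E,p_1,p_2)$. *Spans.* A span $(D,d,c)$ is a pair $d\colon D\to D_0$, $c\colon D\to D_1$ whose legs both have kernel pairs $d_1,d_2\colon D(d)\to D$ and $c_1,c_2\colon D(c)\to D$; a morphism of spans is a triple $(h,h_0,h_1)$ commuting with the legs. The *kernel pair construction* forms the pullback $D(d,c)$ of $c_1$ along $d_2$, with projections $p_1,p_2$ (the generalized triples $(x,y,z)$ with $dx=dy$, $cy=cz$), and the morphisms $\mathrm{dom}=d_1p_1$, $\mathrm{cod}=c_2p_2$,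 $e_1\colon(x,y)\mapsto(x,y,y)$, $e_2\colon(y,z)\mapsto(y,y,z)$. A class $\mathcal M$ of spans is *closed under the kernel pair construction* if $(D,d,c)\in\mathcal M$ implies $(D(d,c),\mathrm{dom},\mathrm{cod})\in\mathcal M$. *Structures.* (a) A reflexive graph is $(C_1,C_0,d,e,c)$ with $d,c\colon C_1\to C_0$, $e\colon C_0\to C_1$, $de=1=ce$; its span part is $(C_1,d,c)$; morphisms are pairs $(f_1,f_0)$ commuting with $d,e,c$. (b) A unital multiplicative graph is a reflexive graph with $m\colon C_2\to C_1$, where $C_2=C_1\times_{C_0}C_1$ is the pullback of $c$ along $d$ with projections $\pi_1,\pi_2$ ($d\pi_1=c\pi_2$), such that $dm=d\pi_2$, $cm=c\pi_1$, $m\langle 1,ed\rangle=1=m\langle ec,1\rangle$; morphisms are graph morphisms with $f_1m=m'(f_1\times_{f_0}f_1)$. It is an internal category if $m$ is associative, and an internal groupoid if moreover there is an inversion $i\colon C_1\to C_1$ with $di=c$, $ci=d$, $m\langle 1,i\rangle=ec$, $m\langle i,1\rangle=ed$; the morphisms are the same. (c) A pregroupoid is a span with $p\colon D(d,c)\to D$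 such that $pe_1=d_1$, $pe_2=c_2$, $dp=dc_2p_2$, $cp=cd_1p_1$; morphisms are span morphisms compatible with $p$. (d) A directed kite consists of $f,r,g,s$ with $fr=1_B=gs$, a span $(D,d,c)$, and $\alpha\colon A\to D$, $\beta\colon B\to D$, $\gamma\colon C\to D$ with $\alpha r=\beta=\gamma s$, $d\alpha=d\beta f$, $c\gamma=c\beta g$; morphisms are natural transformations of such diagrams. It is multiplicative if equipped with $m\colon A\times_BC\to D$ such that $dm=d\gamma\pi_2$, $cm=c\alpha\pi_1$, $m\langle 1_A,sf\rangle=\alpha$, $m\langle rg,1_C\rangle=\gamma$; morphisms of multiplicative directed kites are also compatible with $m$. For a class $\mathcal M$ of spans, $\mathbf{RG}(\mathbb C,\mathcal M)$, $\mathbf{UMG}(\mathbb C,\mathcal M)$, $\mathbf{Cat}(\mathbb C,\mathcal M)$, $\mathbf{Grpd}(\mathbb C,\mathcal M)$, $\mathbf{Span}(\mathbb C,\mathcal M)$, $\mathbf{PreGrpd}(\mathbb C,\mathcal M)$, $\mathbf{DiKite}(\mathbb C,\mathcal M)$, $\mathbf{MKite}(\mathbb C,\mathcal M)$ denote the full subcategories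 of the categories of reflexive graphs, unital multiplicative graphs, internal categories, internal groupoids, spans, pregroupoids, directed kites and multiplicative directed kites on the objects whose span $(C_1,d,c)$, respectively $(D,d,c)$, is in $\mathcal M$. Isomorphism means isomorphism of categories; a section of a functor $F$ is a functor $G$ with $FG=1$. **Theorem (Unification Theorem).** Let $\mathbb C$ be a category with local products, and let $\mathcal M$ be a class of spans in $\mathbb C$ that is closed under the kernel pair construction and contains the span part of every local product. Then the following conditions are equivalent: 1. the forgetful functor $\mathbf{Grpd}(\mathbb C,\mathcal M)\to\mathbf{RG}(\mathbb C,\mathcal M)$ is an isomorphism; 2. the forgetful functor $\mathbf{Grpd}(\mathbb C,\mathcal M)\to\mathbf{RG}(\mathbb C,\mathcal M)$ has a section; 3. the forgetful functor $\mathbf{Cat}(\mathbb C,\mathcal M)\to\mathbf{RG}(\mathbb C,\mathcal M)$ is an isomorphism; 4. the forgetful functor $\mathbf{Cat}(\mathbb C,\mathcal M)\to\mathbf{RG}(\mathbb C,\mathcal M)$ has a section; 5. the forgetful functor $\mathbf{UMG}(\mathbb C,\mathcal M)\to\mathbf{RG}(\mathbb C,\mathcal M)$ is an isomorphism; 6.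 the forgetful functor $\mathbf{UMG}(\mathbb C,\mathcal M)\to\mathbf{RG}(\mathbb C,\mathcal M)$ has a section; 7. the forgetful functor $\mathbf{PreGrpd}(\mathbb C,\mathcal M)\to\mathbf{Span}(\mathbb C,\mathcal M)$ is an isomorphism; 8. the forgetful functor $\mathbf{PreGrpd}(\mathbb C,\mathcal M)\to\mathbf{Span}(\mathbb C,\mathcal M)$ has a section; 9. the forgetful functor $\mathbf{MKite}(\mathbb C,\mathcal M)\to\mathbf{DiKite}(\mathbb C,\mathcal M)$ is an isomorphism; 10. the forgetful functor $\mathbf{MKite}(\mathbb C,\mathcal M)\to\mathbf{DiKite}(\mathbb C,\mathcal M)$ has a section; 11. (Kite Condition) for all spans $(D,d,c)$ and $(E,p_1\colon E\to A,p_2\colon E\to C)$ in $\mathcal M$ with $(p_1,p_2)$ jointly monic, and all morphisms $e_1\colon A\to E$, $e_2\colon C\to E$, $\alpha\colon A\to D$, $\beta\colon E\to D$, $\gamma\colon C\to D$ such that $$p_1e_1=1_A,\quad p_2e_2=1_C,\quad (e_1p_1)(e_2p_2)=(e_2p_2)(e_1p_1),\quad \alpha(p_1e_2p_2)=\beta=\gamma(p_2e_1p_1),$$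 $$d\alpha p_1=d\alpha(p_1e_2p_2),\quad c\gamma p_2=c\gamma(p_2e_1p_1),$$ there is a unique morphism $m\colon E\to D$ with $me_1=\alpha$, $me_2=\gamma$, $dm=d\gamma p_2$ and $cm=c\alpha p_1$. -/

import Mathlib

open CategoryTheory CategoryTheory.Limits

universe v u

namespace RelMaltsev

/-! Composition is written in diagrammatic order: `f ≫ g` is the composite usually written `g f`. -/

/-! ### Local products -/

/-- A category has local products when pullbacks of split epimorphisms along split epimorphisms
exist. The canonical local product of `f` and `g` is Mathlib's chosen `pullback f g`. -/
class HasLocalProducts (C : Type u) [Category.{v} C] : Prop where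
  hasPullback : ∀ {A B C' : C} (f : A ⟶ B) (r : B ⟶ A) (g : C' ⟶ B) (s : B ⟶ C'),
    r ≫ f = 𝟙 B → s ≫ g = 𝟙 B → HasPullback f g

/-- The diagram `A ⇄ E ⇄ C'` (with `p₁, e₁` on the left and `p₂, e₂` on the right) is a local
product: `(E, p₁, p₂)` is the pullback of some `g` along some `f`, split by `s` and `r`, and
`e₁ = ⟨1, s f⟩`, `e₂ = ⟨r g, 1⟩`. -/
def IsLocalProduct {C : Type u} [Category.{v} C] {A E C' : C}
    (p₁ : E ⟶ A) (e₁ : A ⟶ E) (p₂ : E ⟶ C') (e₂ : C' ⟶ E) : Prop :=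
  ∃ (B : C) (f : A ⟶ B) (r : B ⟶ A) (g : C' ⟶ B) (s : B ⟶ C'),
    r ≫ f = 𝟙 B ∧ s ≫ g = 𝟙 B ∧ IsPullback p₁ p₂ f g ∧
    e₁ ≫ p₁ = 𝟙 A ∧ e₁ ≫ p₂ = f ≫ s ∧ e₂ ≫ p₁ = g ≫ r ∧ e₂ ≫ p₂ = 𝟙 C'

/-! ### Spans -/

/-- A span `(D, d, c)` whose two legs have kernel pairs. -/
structure Span (C : Type u) [Category.{v} C] where
  D : C
  D₀ : C
  D₁ : C
  d : D ⟶ D₀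
  c : D ⟶ D₁
  hasKernelPair_d : HasPullback d d
  hasKernelPair_c : HasPullback c c

attribute [instance] Span.hasKernelPair_d Span.hasKernelPair_c

namespace Span

variable {C : Type u} [Category.{v} C]

@[ext]
structure Hom (S T : Span C) where
  h : S.D ⟶ T.D
  h₀ : S.D₀ ⟶ T.D₀
  h₁ : S.D₁ ⟶ T.D₁
  w_d : h ≫ T.d = S.d ≫ h₀
  w_c : h ≫ T.c = S.c ≫ h₁

instance : Category (Span C) where
  Hom := Hom
  id S := ⟨𝟙 _, 𝟙 _, 𝟙 _, by simp, by simp⟩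
  comp f g := ⟨f.h ≫ g.h, f.h₀ ≫ g.h₀, f.h₁ ≫ g.h₁,
    by rw [Category.assoc, g.w_d, ← Category.assoc, f.w_d, Category.assoc],
    by rw [Category.assoc, g.w_c, ← Category.assoc, f.w_c, Category.assoc]⟩

/-- The legs of the span are jointly monic. -/
def JointlyMonic (S : Span C) : Prop :=
  ∀ ⦃Z : C⦄ (x y : Z ⟶ S.D), x ≫ S.d = y ≫ S.d → x ≫ S.c = y ≫ S.c → x = y

end Span

/-! ### Reflexive graphs -/

structure RG (C : Type u) [Category.{v} C] where
  C₁ : C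
  C₀ : C
  d : C₁ ⟶ C₀
  e : C₀ ⟶ C₁
  c : C₁ ⟶ C₀
  e_d : e ≫ d = 𝟙 C₀
  e_c : e ≫ c = 𝟙 C₀

namespace RG

variable {C : Type u} [Category.{v} C]

@[ext]
structure Hom (X Y : RG C) where
  f₁ : X.C₁ ⟶ Y.C₁
  f₀ : X.C₀ ⟶ Y.C₀
  w_d : f₁ ≫ Y.d = X.d ≫ f₀
  w_c : f₁ ≫ Y.c = X.c ≫ f₀
  w_e : X.e ≫ f₁ = f₀ ≫ Y.e

instance : Category (RG C) where
  Hom := Hom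
  id X := ⟨𝟙 _, 𝟙 _, by simp, by simp, by simp⟩
  comp f g := ⟨f.f₁ ≫ g.f₁, f.f₀ ≫ g.f₀,
    by rw [Category.assoc, g.w_d, ← Category.assoc, f.w_d, Category.assoc],
    by rw [Category.assoc, g.w_c, ← Category.assoc, f.w_c, Category.assoc],
    by rw [← Category.assoc, f.w_e, Category.assoc, g.w_e, Category.assoc]⟩

variable [HasLocalProducts C]

instance (X : RG C) : HasPullback X.d X.d :=
  HasLocalProducts.hasPullback X.d X.e X.d X.e X.e_d X.e_d

instance (X : RG C) : HasPullback X.c X.c :=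
  HasLocalProducts.hasPullback X.c X.e X.c X.e X.e_c X.e_c

/-- The object `C₂` of composable pairs exists: it is a local product. -/
instance (X : RG C) : HasPullback X.d X.c :=
  HasLocalProducts.hasPullback X.d X.e X.c X.e X.e_d X.e_c

/-- The span part of a reflexive graph. -/
def toSpan (X : RG C) : Span C where
  D := X.C₁
  D₀ := X.C₀
  D₁ := X.C₀
  d := X.d
  c := X.c
  hasKernelPair_d := inferInstance
  hasKernelPair_c := inferInstance

variable (C) in
def spanFunctor : RG C ⥤ Span C where
  obj := toSpan
  map f := ⟨f.f₁, f.f₀, f.f₀, f.w_d, f.w_c⟩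

/-- `f₂ = f₁ ×_{f₀} f₁` on objects of composable pairs. -/
noncomputable def Hom.f₂ {X Y : RG C} (f : Hom X Y) : pullback X.d X.c ⟶ pullback Y.d Y.c :=
  pullback.map X.d X.c Y.d Y.c f.f₁ f.f₁ f.f₀ f.w_d.symm f.w_c.symm

theorem f₂_id (X : RG C) : Hom.f₂ (𝟙 X) = 𝟙 _ := pullback.map_id

theorem f₂_comp {X Y Z : RG C} (f : X ⟶ Y) (g : Y ⟶ Z) :
    Hom.f₂ (f ≫ g) = Hom.f₂ f ≫ Hom.f₂ g :=
  (pullback.map_comp f.f₁ g.f₁ f.f₁ g.f₁ f.f₀ g.f₀ f.w_d.symm f.w_c.symm g.w_d.symm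
    g.w_c.symm).symm

/-- `e₁ = ⟨1, e d⟩`. -/
noncomputable def e₁ (X : RG C) : X.C₁ ⟶ pullback X.d X.c :=
  pullback.lift (𝟙 _) (X.d ≫ X.e) (by simp [X.e_c])

/-- `e₂ = ⟨e c, 1⟩`. -/
noncomputable def e₂ (X : RG C) : X.C₁ ⟶ pullback X.d X.c :=
  pullback.lift (X.c ≫ X.e) (𝟙 _) (by simp [X.e_d])

end RG

/-! ### The kernel pair construction -/

namespace Span

variable {C : Type u} [Category.{v} C] [HasLocalProducts C]

/-- Second projection of `D(d)` and first projection of `D(c)` are both split by the diagonal. -/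
instance (S : Span C) : HasPullback (pullback.snd S.d S.d) (pullback.fst S.c S.c) :=
  HasLocalProducts.hasPullback _ (pullback.lift (𝟙 _) (𝟙 _) rfl)
    _ (pullback.lift (𝟙 _) (𝟙 _) rfl) (pullback.lift_snd _ _ _) (pullback.lift_fst _ _ _)

/-- The object `D(d,c)` of triples `(x, y, z)` with `d x = d y` and `c y = c z`. -/
noncomputable abbrev triples (S : Span C) : C :=
  pullback (pullback.snd S.d S.d) (pullback.fst S.c S.c)

noncomputable def p₁ (S : Span C) : S.triples ⟶ pullback S.d S.d := pullback.fst _ _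

noncomputable def p₂ (S : Span C) : S.triples ⟶ pullback S.c S.c := pullback.snd _ _

/-- `(x, y, z) ↦ x`. -/
noncomputable def dom (S : Span C) : S.triples ⟶ S.D := S.p₁ ≫ pullback.fst S.d S.d

/-- `(x, y, z) ↦ z`. -/
noncomputable def cod (S : Span C) : S.triples ⟶ S.D := S.p₂ ≫ pullback.snd S.c S.c

/-- `(x, y) ↦ (x, y, y)`. -/
noncomputable def e₁ (S : Span C) : pullback S.d S.d ⟶ S.triples :=
  pullback.lift (𝟙 _) (pullback.snd S.d S.d ≫ pullback.lift (𝟙 _) (𝟙 _) rfl)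
    (by simp [pullback.lift_fst])

/-- `(y, z) ↦ (y, y, z)`. -/
noncomputable def e₂ (S : Span C) : pullback S.c S.c ⟶ S.triples :=
  pullback.lift (pullback.fst S.c S.c ≫ pullback.lift (𝟙 _) (𝟙 _) rfl) (𝟙 _)
    (by simp [pullback.lift_snd])

/-- `x ↦ (x, x, x)`. -/
noncomputable def diag (S : Span C) : S.D ⟶ S.triples :=
  pullback.lift (𝟙 S.D) (𝟙 S.D) rfl ≫ S.e₁

/-- The reflexive graph `(D(d,c), D, dom, Δ, cod)`. -/
noncomputable def kernelGraph (S : Span C) : RG C where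
  C₁ := S.triples
  C₀ := S.D
  d := S.dom
  e := S.diag
  c := S.cod
  e_d := by simp [diag, dom, e₁, p₁, pullback.lift_fst,
    pullback.lift_fst_assoc]
  e_c := by simp [diag, cod, e₁, p₂, pullback.lift_snd,
    pullback.lift_snd_assoc]

/-- The map `(x, y, z) ↦ (h x, h y, h z)` induced by a morphism of spans. -/
noncomputable def Hom.triplesMap {S T : Span C} (f : Hom S T) : S.triples ⟶ T.triples :=
  pullback.map _ _ _ _
    (pullback.map S.d S.d T.d T.d f.h f.h f.h₀ f.w_d.symm f.w_d.symm)
    (pullback.map S.c S.c T.c T.c f.h f.h f.h₁ f.w_c.symm f.w_c.symm)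
    f.h (pullback.lift_snd _ _ _).symm (pullback.lift_fst _ _ _).symm

theorem triplesMap_id (S : Span C) : Hom.triplesMap (𝟙 S) = 𝟙 _ := by
  apply pullback.hom_ext <;> apply pullback.hom_ext <;>
  simp only [Hom.triplesMap, pullback.lift_fst, pullback.lift_snd, Category.assoc,
    Category.id_comp] <;>
  exact congrArg _ (Category.comp_id _)

theorem triplesMap_comp {S T U : Span C} (f : S ⟶ T) (g : T ⟶ U) :
    Hom.triplesMap (f ≫ g) = Hom.triplesMap f ≫ Hom.triplesMap g := by
  apply pullback.hom_ext <;> apply pullback.hom_ext <;>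
  simp only [Hom.triplesMap, pullback.lift_fst, pullback.lift_snd, pullback.lift_fst_assoc,
    pullback.lift_snd_assoc, Category.assoc] <;>
  rfl

end Span

/-! ### Unital multiplicative graphs, internal categories, internal groupoids -/

section

variable (C : Type u) [Category.{v} C] [HasLocalProducts C]

/-- A unital multiplicative graph; `m` sends a composable pair `(x, y)`, `d x = c y`, to the
composite "`x` after `y`". -/
structure UMG where
  graph : RG C
  m : pullback graph.d graph.c ⟶ graph.C₁
  m_d : m ≫ graph.d = pullback.snd graph.d graph.c ≫ graph.d
  m_c : m ≫ graph.c = pullback.fst graph.d graph.c ≫ graph.c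
  e₁_m : graph.e₁ ≫ m = 𝟙 graph.C₁
  e₂_m : graph.e₂ ≫ m = 𝟙 graph.C₁

variable {C}

namespace UMG

@[ext]
structure Hom (X Y : UMG C) where
  hom : RG.Hom X.graph Y.graph
  w_m : X.m ≫ hom.f₁ = hom.f₂ ≫ Y.m

instance : Category (UMG C) where
  Hom := Hom
  id X := ⟨𝟙 X.graph, by
    rw [RG.f₂_id, Category.id_comp]
    exact Category.comp_id _⟩
  comp {X Y Z} f g := ⟨CategoryStruct.comp
    (X := X.graph) (Y := Y.graph) (Z := Z.graph) f.hom g.hom, by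
    rw [RG.f₂_comp, Category.assoc, ← g.w_m, ← Category.assoc, ← f.w_m, Category.assoc]
    rfl⟩

variable (C) in
/-- The forgetful functor to reflexive graphs. -/
def forget : UMG C ⥤ RG C where
  obj X := X.graph
  map f := f.hom

/-- The composite "`x` after `y`" of generalized elements with `d x = c y`. -/
noncomputable def mul (X : UMG C) {Z : C} (x y : Z ⟶ X.graph.C₁)
    (h : x ≫ X.graph.d = y ≫ X.graph.c) : Z ⟶ X.graph.C₁ :=
  pullback.lift x y h ≫ X.m

theorem mul_d (X : UMG C) {Z : C} (x y : Z ⟶ X.graph.C₁)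
    (h : x ≫ X.graph.d = y ≫ X.graph.c) : X.mul x y h ≫ X.graph.d = y ≫ X.graph.d := by
  simp [mul, X.m_d, pullback.lift_snd_assoc]

theorem mul_c (X : UMG C) {Z : C} (x y : Z ⟶ X.graph.C₁)
    (h : x ≫ X.graph.d = y ≫ X.graph.c) : X.mul x y h ≫ X.graph.c = x ≫ X.graph.c := by
  simp [mul, X.m_c, pullback.lift_fst_assoc]

/-- The multiplication is associative. -/
def IsAssociative : ObjectProperty (UMG C) := fun X =>
  ∀ ⦃Z : C⦄ (x y z : Z ⟶ X.graph.C₁) (hxy : x ≫ X.graph.d = y ≫ X.graph.c)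
    (hyz : y ≫ X.graph.d = z ≫ X.graph.c),
    X.mul (X.mul x y hxy) z ((X.mul_d x y hxy).trans hyz) =
      X.mul x (X.mul y z hyz) (hxy.trans (X.mul_c y z hyz).symm)

/-- There is an inversion morphism `i : C₁ ⟶ C₁`. -/
def HasInverses : ObjectProperty (UMG C) := fun X =>
  ∃ (i : X.graph.C₁ ⟶ X.graph.C₁) (hd : i ≫ X.graph.d = X.graph.c)
    (hc : i ≫ X.graph.c = X.graph.d),
    X.mul (𝟙 _) i (by rw [hc, Category.id_comp]) = X.graph.c ≫ X.graph.e ∧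
    X.mul i (𝟙 _) (by rw [hd, Category.id_comp]) = X.graph.d ≫ X.graph.e

end UMG

variable (C)

/-- Internal categories: associative unital multiplicative graphs. -/
abbrev ICat := (UMG.IsAssociative (C := C)).FullSubcategory

/-- Internal groupoids: internal categories with inverses. -/
abbrev IGrpd := (UMG.HasInverses.inverseImage (UMG.IsAssociative (C := C)).ι).FullSubcategory

/-- The forgetful functor from internal categories to reflexive graphs. -/
abbrev ICat.forget : ICat C ⥤ RG C := UMG.IsAssociative.ι ⋙ UMG.forget C

/-- The forgetful functor from internal groupoids to reflexive graphs. -/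
abbrev IGrpd.forget : IGrpd C ⥤ RG C :=
  (UMG.HasInverses.inverseImage (UMG.IsAssociative (C := C)).ι).ι ⋙ ICat.forget C

end

/-! ### Pregroupoids -/

section

variable (C : Type u) [Category.{v} C] [HasLocalProducts C]

/-- A pregroupoid: a span with `p : D(d,c) ⟶ D` such that `p(x,y,y) = x`, `p(y,y,z) = z`,
`d p(x,y,z) = d z` and `c p(x,y,z) = c x`. -/
structure PreGrpd where
  span : Span C
  p : span.triples ⟶ span.D
  e₁_p : span.e₁ ≫ p = pullback.fst span.d span.d
  e₂_p : span.e₂ ≫ p = pullback.snd span.c span.c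
  p_d : p ≫ span.d = span.p₂ ≫ pullback.snd span.c span.c ≫ span.d
  p_c : p ≫ span.c = span.p₁ ≫ pullback.fst span.d span.d ≫ span.c

namespace PreGrpd

variable {C}

@[ext]
structure Hom (X Y : PreGrpd C) where
  hom : Span.Hom X.span Y.span
  w_p : X.p ≫ hom.h = hom.triplesMap ≫ Y.p

instance : Category (PreGrpd C) where
  Hom := Hom
  id X := ⟨𝟙 X.span, by
    rw [Span.triplesMap_id, Category.id_comp]
    exact Category.comp_id _⟩
  comp {X Y Z} f g := ⟨CategoryStruct.comp
    (X := X.span) (Y := Y.span) (Z := Z.span) f.hom g.hom, by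
    rw [Span.triplesMap_comp, Category.assoc, ← g.w_p, ← Category.assoc, ← f.w_p, Category.assoc]
    rfl⟩

variable (C) in
/-- The forgetful functor to spans. -/
def forget : PreGrpd C ⥤ Span C where
  obj X := X.span
  map f := f.hom

end PreGrpd

end

/-! ### Directed kites -/

/-- A directed kite: a kite `f r = 1 = g s`, `α r = β = γ s`, with a span `(D, d, c)` such that
`d α = d β f` and `c β g = c γ`. -/
structure DiKite (C : Type u) [Category.{v} C] where
  A : C
  B : C
  C' : C
  span : Span C
  f : A ⟶ B
  r : B ⟶ A
  g : C' ⟶ B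
  s : B ⟶ C'
  α : A ⟶ span.D
  β : B ⟶ span.D
  γ : C' ⟶ span.D
  r_f : r ≫ f = 𝟙 B
  s_g : s ≫ g = 𝟙 B
  r_α : r ≫ α = β
  s_γ : s ≫ γ = β
  α_d : α ≫ span.d = f ≫ β ≫ span.d
  γ_c : γ ≫ span.c = g ≫ β ≫ span.c

namespace DiKite

variable {C : Type u} [Category.{v} C]

@[ext]
structure Hom (X Y : DiKite C) where
  hA : X.A ⟶ Y.A
  hB : X.B ⟶ Y.B
  hC : X.C' ⟶ Y.C'
  hom : Span.Hom X.span Y.span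
  w_f : hA ≫ Y.f = X.f ≫ hB
  w_r : hB ≫ Y.r = X.r ≫ hA
  w_g : hC ≫ Y.g = X.g ≫ hB
  w_s : hB ≫ Y.s = X.s ≫ hC
  w_α : hA ≫ Y.α = X.α ≫ hom.h
  w_β : hB ≫ Y.β = X.β ≫ hom.h
  w_γ : hC ≫ Y.γ = X.γ ≫ hom.h

theorem paste {X Y Z X' Y' Z' : C} {a : X ⟶ Y} {b : Y ⟶ Z} {k : X ⟶ X'} {l : Y ⟶ Y'} {n : Z ⟶ Z'}
    {a' : X' ⟶ Y'} {b' : Y' ⟶ Z'} (h : a ≫ l = k ≫ a') (h' : b ≫ n = l ≫ b') :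
    (a ≫ b) ≫ n = k ≫ a' ≫ b' := by
  rw [Category.assoc, h', ← Category.assoc, h, Category.assoc]

instance : Category (DiKite C) where
  Hom := Hom
  id X := ⟨𝟙 _, 𝟙 _, 𝟙 _, 𝟙 X.span, by simp, by simp, by simp, by simp,
    (Category.id_comp _).trans (Category.comp_id _).symm,
    (Category.id_comp _).trans (Category.comp_id _).symm,
    (Category.id_comp _).trans (Category.comp_id _).symm⟩
  comp {X Y Z} f g := ⟨f.hA ≫ g.hA, f.hB ≫ g.hB, f.hC ≫ g.hC,
    (show X.span ⟶ Y.span from f.hom) ≫ (show Y.span ⟶ Z.span from g.hom),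
    paste f.w_f g.w_f, paste f.w_r g.w_r, paste f.w_g g.w_g, paste f.w_s g.w_s,
    paste f.w_α g.w_α, paste f.w_β g.w_β, paste f.w_γ g.w_γ⟩

variable (C) in
/-- The direction of a directed kite. -/
def spanFunctor : DiKite C ⥤ Span C where
  obj X := X.span
  map f := f.hom

variable [HasLocalProducts C]

instance (X : DiKite C) : HasPullback X.f X.g :=
  HasLocalProducts.hasPullback X.f X.r X.g X.s X.r_f X.s_g

/-- `e₁ = ⟨1, s f⟩`. -/
noncomputable def e₁ (X : DiKite C) : X.A ⟶ pullback X.f X.g :=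
  pullback.lift (𝟙 _) (X.f ≫ X.s) (by simp [X.s_g])

/-- `e₂ = ⟨r g, 1⟩`. -/
noncomputable def e₂ (X : DiKite C) : X.C' ⟶ pullback X.f X.g :=
  pullback.lift (X.g ≫ X.r) (𝟙 _) (by simp [X.r_f])

/-- The morphism `h_A ×_{h_B} h_C` of local products. -/
noncomputable def Hom.pullbackMap {X Y : DiKite C} (h : Hom X Y) :
    pullback X.f X.g ⟶ pullback Y.f Y.g :=
  pullback.map X.f X.g Y.f Y.g h.hA h.hC h.hB h.w_f.symm h.w_g.symm

theorem pullbackMap_id (X : DiKite C) : Hom.pullbackMap (𝟙 X) = 𝟙 _ := pullback.map_id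

theorem pullbackMap_comp {X Y Z : DiKite C} (f : X ⟶ Y) (g : Y ⟶ Z) :
    Hom.pullbackMap (f ≫ g) = Hom.pullbackMap f ≫ Hom.pullbackMap g :=
  (pullback.map_comp f.hA g.hA f.hC g.hC f.hB g.hB f.w_f.symm f.w_g.symm g.w_f.symm
    g.w_g.symm).symm

end DiKite

section

variable (C : Type u) [Category.{v} C] [HasLocalProducts C]

/-- A multiplicative directed kite. -/
structure MKite where
  kite : DiKite C
  m : pullback kite.f kite.g ⟶ kite.span.D
  m_d : m ≫ kite.span.d = pullback.snd kite.f kite.g ≫ kite.γ ≫ kite.span.d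
  m_c : m ≫ kite.span.c = pullback.fst kite.f kite.g ≫ kite.α ≫ kite.span.c
  e₁_m : kite.e₁ ≫ m = kite.α
  e₂_m : kite.e₂ ≫ m = kite.γ

namespace MKite

variable {C}

@[ext]
structure Hom (X Y : MKite C) where
  hom : DiKite.Hom X.kite Y.kite
  w_m : X.m ≫ hom.hom.h = hom.pullbackMap ≫ Y.m

instance : Category (MKite C) where
  Hom := Hom
  id X := ⟨𝟙 X.kite, by
    rw [DiKite.pullbackMap_id, Category.id_comp]
    exact Category.comp_id _⟩
  comp {X Y Z} f g := ⟨CategoryStruct.comp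
    (X := X.kite) (Y := Y.kite) (Z := Z.kite) f.hom g.hom, by
    rw [DiKite.pullbackMap_comp, Category.assoc, ← g.w_m, ← Category.assoc, ← f.w_m, Category.assoc]
    rfl⟩

variable (C) in
/-- The forgetful functor to directed kites. -/
def forget : MKite C ⥤ DiKite C where
  obj X := X.kite
  map f := f.hom

end MKite

end

/-! ### Functors -/

section

universe v₁ v₂ u₁ u₂

variable {X : Type u₁} [Category.{v₁} X] {Y : Type u₂} [Category.{v₂} Y]

/-- An isomorphism of categories (not merely an equivalence). -/
def IsIsoOfCategories (F : X ⥤ Y) : Prop := ∃ G : Y ⥤ X, F ⋙ G = 𝟭 X ∧ G ⋙ F = 𝟭 Y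

/-- `F` has a section: a functor `G` with `F G = 1`. -/
def HasSection (F : X ⥤ Y) : Prop := ∃ G : Y ⥤ X, G ⋙ F = 𝟭 Y

/-- The pullback of `F` along the inclusion of the full subcategory of `Y` given by `P`. -/
def restrict (F : X ⥤ Y) (P : ObjectProperty Y) :
    (P.inverseImage F).FullSubcategory ⥤ P.FullSubcategory :=
  P.lift ((P.inverseImage F).ι ⋙ F) fun x => x.property

end

/-! ### Notions relative to a class of spans -/

section

variable {C : Type u} [Category.{v} C] [HasLocalProducts C] (M : ObjectProperty (Span C))

/-- If `(D, d, c)` is in `M` then so is `(D(d,c), dom, cod)`. -/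
def ClosedUnderKernelPairs : Prop := ∀ S : Span C, M S → M S.kernelGraph.toSpan

/-- `M` contains the span part of every local product. -/
def ContainsLocalProducts : Prop :=
  ∀ (S : Span C) (e₁ : S.D₀ ⟶ S.D) (e₂ : S.D₁ ⟶ S.D), IsLocalProduct S.d e₁ S.c e₂ → M S

/-- `Grpd(C, M) ⥤ RG(C, M)`. -/
def grpdToRG := restrict (IGrpd.forget C) (M.inverseImage (RG.spanFunctor C))

/-- `Cat(C, M) ⥤ RG(C, M)`. -/
def catToRG := restrict (ICat.forget C) (M.inverseImage (RG.spanFunctor C))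

/-- `UMG(C, M) ⥤ RG(C, M)`. -/
def umgToRG := restrict (UMG.forget C) (M.inverseImage (RG.spanFunctor C))

/-- `PreGrpd(C, M) ⥤ Span(C, M)`. -/
def preGrpdToSpan := restrict (PreGrpd.forget C) M

/-- `MKite(C, M) ⥤ DiKite(C, M)`. -/
def mKiteToDiKite := restrict (MKite.forget C) (M.inverseImage (DiKite.spanFunctor C))

/-- The Kite Condition relative to `M`. Here `S` is the span `(D, d, c)` and `T` is the span
`(E, p₁, p₂)` with `p₁ = T.d : E ⟶ A` and `p₂ = T.c : E ⟶ C'`. -/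
def KiteCondition : Prop :=
  ∀ (S T : Span C), M S → M T → T.JointlyMonic →
    ∀ (e₁ : T.D₀ ⟶ T.D) (e₂ : T.D₁ ⟶ T.D)
      (α : T.D₀ ⟶ S.D) (β : T.D ⟶ S.D) (γ : T.D₁ ⟶ S.D),
      e₁ ≫ T.d = 𝟙 T.D₀ → e₂ ≫ T.c = 𝟙 T.D₁ →
      (T.c ≫ e₂) ≫ (T.d ≫ e₁) = (T.d ≫ e₁) ≫ (T.c ≫ e₂) →
      (T.c ≫ e₂ ≫ T.d) ≫ α = β → (T.d ≫ e₁ ≫ T.c) ≫ γ = β →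
      T.d ≫ α ≫ S.d = (T.c ≫ e₂ ≫ T.d) ≫ α ≫ S.d →
      T.c ≫ γ ≫ S.c = (T.d ≫ e₁ ≫ T.c) ≫ γ ≫ S.c →
      ∃! m : T.D ⟶ S.D, e₁ ≫ m = α ∧ e₂ ≫ m = γ ∧
        m ≫ S.d = T.c ≫ γ ≫ S.d ∧ m ≫ S.c = T.d ≫ α ≫ S.c

end

end RelMaltsev

/-!
All three kinds of structure are multiplications on directed kites: a unital multiplicative graph
is a multiplication on the kite `C₁ ⇄ C₀ ⇄ C₁`, and a pregroupoid, that is, a Mal'tsev operation `p`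
on a span, is one on the kite `D(d) ⇄ D ⇄ D(c)`. A section of a forgetful functor is therefore a
choice of multiplications that is natural with respect to all morphisms of the base category. For a
section of `UMG ⥤ RG`, applied to the kernel graph of a span, the middle component of the product of
`(y, x, x)` and `(z, z, y)` is a natural Mal'tsev operation.

A Mal'tsev operation on `(D, d, c)` fills every kite, by `m = p (α p₁, β, γ p₂)`. Such an `m` is
itself a morphism of spans from `(E, p₂, p₁)` to `(D, d, c)`, and `E` carries a Mal'tsev operation
`q` for which `q (e₁ p₁, e₁ p₁ e₂ p₂, e₂ p₂) = 1`, as can be checked on the jointly monic legs.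
Naturality of the operations along `m` thus makes `m` unique.

Conversely, the Kite Condition gives every directed kite over `M` exactly one multiplication.
Uniqueness makes multiplications natural, and it yields the further axioms: both bracketings of a
triple product are multiplications on the same kite, and so are `p (x, v, w)` and `x · p (1, v, w)`,
which makes `p (1, x, 1)` the inverse of `x`.
-/

namespace RelMaltsev

/-! ### Functors restricted to full subcategories -/

section

universe v₁ v₂ u₁ u₂

variable {X : Type u₁} [Category.{v₁} X] {Y : Type u₂} [Category.{v₂} Y]

theorem IsIsoOfCategories.hasSection {F : X ⥤ Y} (h : IsIsoOfCategories F) : HasSection F :=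
  let ⟨G, _, hG⟩ := h
  ⟨G, hG⟩

theorem isIsoOfCategories_of_isIso {F : X ⥤ Y} (_ : F.IsIso) : IsIsoOfCategories F :=
  ⟨F.asIsomorphism.inverse, F.asIsomorphism.unit_eq.symm, F.asIsomorphism.counit_eq⟩

variable {F : X ⥤ Y} {P : ObjectProperty Y}

/-- The inclusion, over `P`, of the full subcategory of `X` given by `Q`. It is the comparison
between `restrict (Q.ι ⋙ F) P` and `restrict F P`. -/
def forgetOver (F : X ⥤ Y) (P : ObjectProperty Y) (Q : ObjectProperty X) :
    (P.inverseImage (Q.ι ⋙ F)).FullSubcategory ⥤ (P.inverseImage F).FullSubcategory :=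
  (P.inverseImage F).lift ((P.inverseImage (Q.ι ⋙ F)).ι ⋙ Q.ι) fun x => x.property

theorem isIso_forgetOver {Q : ObjectProperty X} (hQ : ∀ x, P (F.obj x) → Q x) :
    (forgetOver F P Q).IsIso where
  faithful := .of_comp_iso (ObjectProperty.liftCompιIso _ _ _)
  full := .of_comp_faithful_iso (ObjectProperty.liftCompιIso _ _ _)
  bijective_obj :=
    ⟨fun ⟨⟨_, _⟩, _⟩ ⟨⟨_, _⟩, _⟩ h => by cases h; rfl,
      fun x => ⟨⟨⟨x.obj, hQ x.obj x.property⟩, x.property⟩, rfl⟩⟩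

theorem isIso_restrict_ι_comp (_ : (restrict F P).IsIso) {Q : ObjectProperty X}
    (hQ : ∀ x, P (F.obj x) → Q x) : (restrict (Q.ι ⋙ F) P).IsIso :=
  have := isIso_forgetOver hQ
  inferInstanceAs (forgetOver F P Q ⋙ restrict F P).IsIso

theorem HasSection.of_restrict_ι_comp {Q : ObjectProperty X}
    (h : HasSection (restrict (Q.ι ⋙ F) P)) : HasSection (restrict F P) :=
  let ⟨G, hG⟩ := h
  ⟨G ⋙ forgetOver F P Q, hG⟩

theorem HasSection.exists_lift (h : HasSection (restrict F P)) :
    ∃ g : ∀ y, P y → X, (∀ y hy, F.obj (g y hy) = y) ∧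
      ∀ {y y'} hy hy' (f : y ⟶ y'), ∃ φ : g y hy ⟶ g y' hy', F.IsHomLift f φ := by
  obtain ⟨G, hG⟩ := h
  have hobj (y : P.FullSubcategory) : F.obj (G.obj y).obj = y.obj :=
    congrArg (·.obj) (Functor.congr_obj hG y)
  refine ⟨fun y hy => (G.obj ⟨y, hy⟩).obj, fun y hy => hobj ⟨y, hy⟩, fun {y y'} hy hy' f =>
    ⟨(G.map (ObjectProperty.homMk f)).hom, IsHomLift.of_fac' _ _ _ (hobj _) (hobj _) ?_⟩⟩
  have := congrArg P.ι.map (Functor.congr_hom hG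
    (ObjectProperty.homMk f : (⟨y, hy⟩ : P.FullSubcategory) ⟶ ⟨y', hy'⟩))
  simp only [Functor.map_comp, eqToHom_map] at this
  exact this

end

/-! ### Multiplications on directed kites -/

section

variable {C : Type u} [Category.{v} C] [HasLocalProducts C]

attribute [local simp] pullback.lift_fst pullback.lift_snd pullback.lift_fst_assoc
  pullback.lift_snd_assoc

namespace DiKite

/-- The morphism `m` makes the directed kite `X` multiplicative. -/
structure IsMul (X : DiKite C) (m : pullback X.f X.g ⟶ X.span.D) : Prop where
  comp_d : m ≫ X.span.d = pullback.snd X.f X.g ≫ X.γ ≫ X.span.d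
  comp_c : m ≫ X.span.c = pullback.fst X.f X.g ≫ X.α ≫ X.span.c
  e₁_comp : X.e₁ ≫ m = X.α
  e₂_comp : X.e₂ ≫ m = X.γ

/-- Compatibility of a morphism of directed kites with multiplications on its ends. -/
def Hom.PreservesMul {X Y : DiKite C} (f : Hom X Y) (m : pullback X.f X.g ⟶ X.span.D)
    (m' : pullback Y.f Y.g ⟶ Y.span.D) : Prop :=
  m ≫ f.hom.h = f.pullbackMap ≫ m'

namespace IsMul

variable {X : DiKite C} {m : pullback X.f X.g ⟶ X.span.D} (hm : X.IsMul m)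
include hm

theorem lift_left {Z : C} (x : Z ⟶ X.A) {y : Z ⟶ X.C'} (h : x ≫ X.f = y ≫ X.g)
    (hy : y = x ≫ X.f ≫ X.s) : pullback.lift x y h ≫ m = x ≫ X.α := by
  rw [← hm.e₁_comp, ← Category.assoc]
  congr 1
  apply pullback.hom_ext <;> simp [e₁, hy]

theorem lift_right {Z : C} {x : Z ⟶ X.A} (y : Z ⟶ X.C') (h : x ≫ X.f = y ≫ X.g)
    (hx : x = y ≫ X.g ≫ X.r) : pullback.lift x y h ≫ m = y ≫ X.γ := by
  rw [← hm.e₂_comp, ← Category.assoc]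
  congr 1
  apply pullback.hom_ext <;> simp [e₂, hx]

end IsMul

/-- The directed kite obtained by composing the direction with a morphism of spans. -/
abbrev along (X : DiKite C) {T : Span C} (k : Span.Hom X.span T) : DiKite C where
  A := X.A
  B := X.B
  C' := X.C'
  span := T
  f := X.f
  r := X.r
  g := X.g
  s := X.s
  α := X.α ≫ k.h
  β := X.β ≫ k.h
  γ := X.γ ≫ k.h
  r_f := X.r_f
  s_g := X.s_g
  r_α := by rw [← Category.assoc, X.r_α]
  s_γ := by rw [← Category.assoc, X.s_γ]
  α_d := by simp [k.w_d, reassoc_of% X.α_d]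
  γ_c := by simp [k.w_c, reassoc_of% X.γ_c]

theorem IsMul.along {X : DiKite C} {m : pullback X.f X.g ⟶ X.span.D} (hm : X.IsMul m)
    {T : Span C} (k : Span.Hom X.span T) : (X.along k).IsMul (m ≫ k.h) where
  comp_d := by simp [k.w_d, reassoc_of% hm.comp_d]
  comp_c := by simp [k.w_c, reassoc_of% hm.comp_c]
  e₁_comp := (Category.assoc _ _ _).symm.trans (congrArg (· ≫ k.h) hm.e₁_comp)
  e₂_comp := (Category.assoc _ _ _).symm.trans (congrArg (· ≫ k.h) hm.e₂_comp)

theorem IsMul.pullbackMap_comp {X Y : DiKite C} {m : pullback Y.f Y.g ⟶ Y.span.D} (hm : Y.IsMul m)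
    (f : Hom X Y) : (X.along f.hom).IsMul (f.pullbackMap ≫ m) where
  comp_d := by simp [hm.comp_d, Hom.pullbackMap, reassoc_of% f.w_γ]
  comp_c := by simp [hm.comp_c, Hom.pullbackMap, reassoc_of% f.w_α]
  e₁_comp := by
    have : (X.along f.hom).e₁ ≫ f.pullbackMap = f.hA ≫ Y.e₁ := by
      apply pullback.hom_ext <;> simp [e₁, Hom.pullbackMap, reassoc_of% f.w_f, f.w_s]
    rw [reassoc_of% this, hm.e₁_comp, f.w_α]
  e₂_comp := by
    have : (X.along f.hom).e₂ ≫ f.pullbackMap = f.hC ≫ Y.e₂ := by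
      apply pullback.hom_ext <;> simp [e₂, Hom.pullbackMap, reassoc_of% f.w_g, f.w_r]
    rw [reassoc_of% this, hm.e₂_comp, f.w_γ]

end DiKite

/-- Every directed kite whose direction is in `M` has exactly one multiplication. -/
def UniqueMul (M : ObjectProperty (Span C)) : Prop :=
  ∀ X : DiKite C, M X.span → ∃! m, X.IsMul m

/-- Both composites in the naturality square are multiplications on `X.along f.hom`. -/
theorem UniqueMul.preservesMul {M : ObjectProperty (Span C)} (h : UniqueMul M) {X Y : DiKite C}
    (hY : M Y.span) {m : pullback X.f X.g ⟶ X.span.D} {m' : pullback Y.f Y.g ⟶ Y.span.D}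
    (hm : X.IsMul m) (hm' : Y.IsMul m') (f : DiKite.Hom X Y) : f.PreservesMul m m' :=
  (h (X.along f.hom) hY).unique (hm.along f.hom) (hm'.pullbackMap_comp f)

/-! ### Functors that forget a multiplication -/

section

universe v₁ v₂ v₃ u₁ u₂ u₃

variable {X : Type u₁} [Category.{v₁} X] {Y : Type u₂} [Category.{v₂} Y]
  {Z : Type u₃} [Category.{v₃} Z]

/-- A choice of multiplications on the directed kites `K y`, for `y` in `P`, that is preserved by
all morphisms `K f`. -/
structure NaturalMul (K : Y ⥤ DiKite C) (P : ObjectProperty Y) where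
  mul (y : Y) (hy : P y) : pullback (K.obj y).f (K.obj y).g ⟶ (K.obj y).span.D
  isMul (y : Y) (hy : P y) : (K.obj y).IsMul (mul y hy)
  preservesMul {y y' : Y} (hy : P y) (hy' : P y') (f : y ⟶ y') :
    DiKite.Hom.PreservesMul (K.map f) (mul y hy) (mul y' hy')

/-- Natural multiplications pull back along a functor `L`. -/
def NaturalMul.whisker {K : Y ⥤ DiKite C} {P : ObjectProperty Y} (N : NaturalMul K P)
    (L : Z ⥤ Y) {Q : ObjectProperty Z} (hQ : ∀ z, Q z → P (L.obj z)) : NaturalMul (L ⋙ K) Q where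
  mul z hz := N.mul (L.obj z) (hQ z hz)
  isMul z hz := N.isMul _ (hQ z hz)
  preservesMul hz hz' f := N.preservesMul (hQ _ hz) (hQ _ hz') (L.map f)

/-- `F` presents `X` as the category of objects `y` of `Y` equipped with a multiplication on the
directed kite `K y`, so that multiplicative kites, pregroupoids and unital multiplicative graphs
can be treated alike. -/
structure ForgetsMul (F : X ⥤ Y) (K : Y ⥤ DiKite C) where
  mul (x : X) :
    pullback (K.obj (F.obj x)).f (K.obj (F.obj x)).g ⟶ (K.obj (F.obj x)).span.D
  isMul (x : X) : (K.obj (F.obj x)).IsMul (mul x)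
  faithful : F.Faithful
  exists_map_eq_iff {x x' : X} (f : F.obj x ⟶ F.obj x') :
    (∃ φ, F.map φ = f) ↔ DiKite.Hom.PreservesMul (K.map f) (mul x) (mul x')
  ofMul (y : Y) (m : pullback (K.obj y).f (K.obj y).g ⟶ (K.obj y).span.D)
    (hm : (K.obj y).IsMul m) : X
  obj_ofMul (y : Y) (m) (hm : (K.obj y).IsMul m) : F.obj (ofMul y m hm) = y
  ofMul_mul (x : X) : ofMul (F.obj x) (mul x) (isMul x) = x

namespace ForgetsMul

variable {F : X ⥤ Y} {K : Y ⥤ DiKite C} (h : ForgetsMul F K)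
include h

/-- The multiplication of `x` on the kite of an object equal to `F x`. -/
def mulOfEq {x : X} {y : Y} (e : F.obj x = y) :
    pullback (K.obj y).f (K.obj y).g ⟶ (K.obj y).span.D :=
  e ▸ h.mul x

theorem isMul_mulOfEq {x : X} {y : Y} (e : F.obj x = y) : (K.obj y).IsMul (h.mulOfEq e) := by
  subst e
  exact h.isMul x

theorem preservesMul_of_isHomLift {x x' : X} {y y' : Y} (e : F.obj x = y) (e' : F.obj x' = y')
    {f : y ⟶ y'} {φ : x ⟶ x'} (hφ : F.IsHomLift f φ) :
    DiKite.Hom.PreservesMul (K.map f) (h.mulOfEq e) (h.mulOfEq e') := by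
  cases hφ
  exact (h.exists_map_eq_iff _).1 ⟨φ, rfl⟩

theorem nonempty_naturalMul {P : ObjectProperty Y} (hF : HasSection (restrict F P)) :
    Nonempty (NaturalMul K P) := by
  obtain ⟨g, hg, hlift⟩ := hF.exists_lift
  refine ⟨fun y hy => h.mulOfEq (hg y hy), fun y hy => h.isMul_mulOfEq _, fun hy hy' f => ?_⟩
  obtain ⟨φ, hφ⟩ := hlift hy hy' f
  exact h.preservesMul_of_isHomLift _ _ hφ

variable {M : ObjectProperty (Span C)}

theorem eq_of_obj_eq (hM : UniqueMul M) {x x' : X} (hx : M (K.obj (F.obj x)).span)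
    (e : F.obj x = F.obj x') : x = x' := by
  have ofMul_congr : ∀ {y y' : Y} {m m'} (hm : (K.obj y).IsMul m) (hm' : (K.obj y').IsMul m'),
      M (K.obj y).span → y = y' → h.ofMul y m hm = h.ofMul y' m' hm' := by
    rintro y _ m m' hm hm' hy rfl
    obtain rfl := (hM _ hy).unique hm hm'
    rfl
  rw [← h.ofMul_mul x, ← h.ofMul_mul x', ofMul_congr (h.isMul x) (h.isMul x') hx e]

theorem isIso_restrict (hM : UniqueMul M) :
    (restrict F (M.inverseImage (K ⋙ DiKite.spanFunctor C))).IsIso where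
  faithful := ⟨fun {_ _} _ _ hab =>
    ObjectProperty.hom_ext _ (h.faithful.map_injective (congrArg (·.hom) hab))⟩
  full := ⟨fun {x x'} f => by
    obtain ⟨φ, hφ⟩ := (h.exists_map_eq_iff f.hom).2
      (hM.preservesMul x'.property (h.isMul x.obj) (h.isMul x'.obj) _)
    exact ⟨ObjectProperty.homMk φ, ObjectProperty.hom_ext _ hφ⟩⟩
  bijective_obj := by
    refine ⟨fun x x' hxx' => ?_, fun ⟨y, hy⟩ => ?_⟩
    · obtain ⟨x, hx⟩ := x
      obtain ⟨x', hx'⟩ := x'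
      obtain rfl := h.eq_of_obj_eq hM hx (congrArg (·.obj) hxx')
      rfl
    · obtain ⟨m, hm, -⟩ := hM (K.obj y) hy
      have e := h.obj_ofMul y m hm
      refine ⟨⟨h.ofMul y m hm, ?_⟩, ?_⟩
      · exact (e.symm ▸ hy : M.inverseImage (K ⋙ DiKite.spanFunctor C) (F.obj _))
      · exact ObjectProperty.FullSubcategory.ext e

end ForgetsMul

end

/-- A multiplicative directed kite is a directed kite with a multiplication. -/
def MKite.forgetsMul : ForgetsMul (MKite.forget C) (𝟭 (DiKite C)) where
  mul X := X.m
  isMul X := ⟨X.m_d, X.m_c, X.e₁_m, X.e₂_m⟩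
  faithful := ⟨MKite.Hom.ext⟩
  exists_map_eq_iff _ := ⟨fun ⟨φ, hφ⟩ => hφ ▸ φ.w_m, fun hf => ⟨⟨_, hf⟩, rfl⟩⟩
  ofMul X m hm := ⟨X, m, hm.comp_d, hm.comp_c, hm.e₁_comp, hm.e₂_comp⟩
  obj_ofMul _ _ _ := rfl
  ofMul_mul _ := rfl

/-! ### Mal'tsev operations on spans -/

namespace Span

/-- `(x, y, z) ↦ y`. -/
noncomputable def mid (S : Span C) : S.triples ⟶ S.D := S.p₁ ≫ pullback.snd S.d S.d

theorem p₂_fst (S : Span C) : S.p₂ ≫ pullback.fst S.c S.c = S.mid := pullback.condition.symm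

theorem dom_d (S : Span C) : S.dom ≫ S.d = S.mid ≫ S.d := by
  simp [dom, mid, pullback.condition]

theorem mid_c (S : Span C) : S.mid ≫ S.c = S.cod ≫ S.c := by
  simp [← p₂_fst, cod, pullback.condition]

theorem triples_ext {S : Span C} {Z : C} {a b : Z ⟶ S.triples}
    (h₁ : a ≫ S.dom = b ≫ S.dom) (h₂ : a ≫ S.mid = b ≫ S.mid) (h₃ : a ≫ S.cod = b ≫ S.cod) :
    a = b := by
  have h₂' := h₂
  rw [← p₂_fst] at h₂'
  simp only [dom, mid, cod, p₁, p₂] at h₁ h₂ h₂' h₃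
  apply pullback.hom_ext <;> apply pullback.hom_ext <;> simpa

/-- The generalized element `(x, y, z)` of `S.triples`. -/
noncomputable def triple (S : Span C) {Z : C} (x y z : Z ⟶ S.D) (h : x ≫ S.d = y ≫ S.d)
    (h' : y ≫ S.c = z ≫ S.c) : Z ⟶ S.triples :=
  pullback.lift (pullback.lift x y h) (pullback.lift y z h') (by simp)

section

variable (S : Span C) {Z : C} (x y z : Z ⟶ S.D) (h : x ≫ S.d = y ≫ S.d) (h' : y ≫ S.c = z ≫ S.c)

@[simp]
theorem triple_dom : S.triple x y z h h' ≫ S.dom = x := by simp [triple, dom, p₁]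

@[simp]
theorem triple_mid : S.triple x y z h h' ≫ S.mid = y := by simp [triple, mid, p₁]

@[simp]
theorem triple_cod : S.triple x y z h h' ≫ S.cod = z := by simp [triple, cod, p₂]

theorem triple_p₂ : S.triple x y z h h' ≫ S.p₂ = pullback.lift y z h' := pullback.lift_snd _ _ _

@[simp]
theorem comp_triple {W : C} (a : W ⟶ Z) : a ≫ S.triple x y z h h' =
    S.triple (a ≫ x) (a ≫ y) (a ≫ z) (by simp [h]) (by simp [h']) := by
  apply triples_ext <;> simp

end

theorem e₁_eq_triple (S : Span C) : S.e₁ =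
    S.triple (pullback.fst _ _) (pullback.snd _ _) (pullback.snd _ _) pullback.condition rfl := by
  apply triples_ext <;> simp [triple, e₁, dom, mid, cod, p₁, p₂]

theorem e₂_eq_triple (S : Span C) : S.e₂ =
    S.triple (pullback.fst _ _) (pullback.fst _ _) (pullback.snd _ _) rfl pullback.condition := by
  apply triples_ext <;> simp [triple, e₂, dom, mid, cod, p₁, p₂]

theorem diag_eq_triple (S : Span C) : S.diag = S.triple (𝟙 _) (𝟙 _) (𝟙 _) rfl rfl := by
  apply triples_ext <;> simp [triple, diag, e₁, dom, mid, cod, p₁, p₂]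

section

variable {S T : Span C} (f : Hom S T)

@[simp]
theorem Hom.triplesMap_dom : f.triplesMap ≫ T.dom = S.dom ≫ f.h := by simp [triplesMap, dom, p₁]

@[simp]
theorem Hom.triplesMap_mid : f.triplesMap ≫ T.mid = S.mid ≫ f.h := by simp [triplesMap, mid, p₁]

@[simp]
theorem Hom.triplesMap_cod : f.triplesMap ≫ T.cod = S.cod ≫ f.h := by simp [triplesMap, cod, p₂]

@[simp]
theorem triple_triplesMap {Z : C} (x y z : Z ⟶ S.D)
    (h : x ≫ S.d = y ≫ S.d) (h' : y ≫ S.c = z ≫ S.c) :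
    S.triple x y z h h' ≫ f.triplesMap = T.triple (x ≫ f.h) (y ≫ f.h) (z ≫ f.h)
      (by simp [f.w_d, reassoc_of% h]) (by simp [f.w_c, reassoc_of% h']) := by
  apply triples_ext <;> simp [reassoc_of% triple_dom, reassoc_of% triple_mid,
    reassoc_of% triple_cod]

end

/-- The morphism `p` is the operation of a pregroupoid with underlying span `S`; the unit laws are
stated on generalized elements. -/
structure IsMaltsev (S : Span C) (p : S.triples ⟶ S.D) : Prop where
  triple_left : ∀ {Z : C} (x y : Z ⟶ S.D) (h : x ≫ S.d = y ≫ S.d), S.triple x y y h rfl ≫ p = x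
  triple_right : ∀ {Z : C} (y z : Z ⟶ S.D) (h : y ≫ S.c = z ≫ S.c), S.triple y y z rfl h ≫ p = z
  comp_d : p ≫ S.d = S.cod ≫ S.d
  comp_c : p ≫ S.c = S.dom ≫ S.c

/-- The span with its legs interchanged. -/
abbrev flip (S : Span C) : Span C where
  D := S.D
  D₀ := S.D₁
  D₁ := S.D₀
  d := S.c
  c := S.d
  hasKernelPair_d := S.hasKernelPair_c
  hasKernelPair_c := S.hasKernelPair_d

/-- `(x, y, z) ↦ (z, y, x)`. -/
noncomputable def reverse (S : Span C) : S.flip.triples ⟶ S.triples :=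
  S.triple S.flip.cod S.flip.mid S.flip.dom S.flip.mid_c.symm S.flip.dom_d.symm

theorem triple_reverse (S : Span C) {Z : C} (x y z : Z ⟶ S.D) (h : x ≫ S.c = y ≫ S.c)
    (h' : y ≫ S.d = z ≫ S.d) :
    S.flip.triple x y z h h' ≫ S.reverse = S.triple z y x h'.symm h.symm := by
  have hx := S.flip.triple_dom x y z h h'
  have hy := S.flip.triple_mid x y z h h'
  have hz := S.flip.triple_cod x y z h h'
  apply triples_ext <;> simp [reverse, hx, hy, hz]

namespace IsMaltsev

variable {S : Span C} {p : S.triples ⟶ S.D} (hp : S.IsMaltsev p)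
include hp

theorem triple_comp_d {Z : C} (x y z : Z ⟶ S.D) (h : x ≫ S.d = y ≫ S.d)
    (h' : y ≫ S.c = z ≫ S.c) : (S.triple x y z h h' ≫ p) ≫ S.d = z ≫ S.d := by
  rw [Category.assoc, hp.comp_d, ← Category.assoc, triple_cod]

theorem triple_comp_c {Z : C} (x y z : Z ⟶ S.D) (h : x ≫ S.d = y ≫ S.d)
    (h' : y ≫ S.c = z ≫ S.c) : (S.triple x y z h h' ≫ p) ≫ S.c = x ≫ S.c := by
  rw [Category.assoc, hp.comp_c, ← Category.assoc, triple_dom]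

theorem flip : S.flip.IsMaltsev (S.reverse ≫ p) where
  triple_left x y h := by rw [← Category.assoc, triple_reverse, hp.triple_right]
  triple_right y z h := by rw [← Category.assoc, triple_reverse, hp.triple_left]
  comp_d := hp.triple_comp_c _ _ _ _ _
  comp_c := hp.triple_comp_d _ _ _ _ _

end IsMaltsev

/-- The directed kite `D(d) ⇄ D ⇄ D(c)` over the span `(D, d, c)`. Its multiplications are the
Mal'tsev operations on the span. -/
noncomputable abbrev kernelKite (S : Span C) : DiKite C where
  A := pullback S.d S.d
  B := S.D
  C' := pullback S.c S.c
  span := S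
  f := pullback.snd _ _
  r := pullback.lift (𝟙 _) (𝟙 _) rfl
  g := pullback.fst _ _
  s := pullback.lift (𝟙 _) (𝟙 _) rfl
  α := pullback.fst _ _
  β := 𝟙 _
  γ := pullback.snd _ _
  r_f := by simp
  s_g := by simp
  r_α := by simp
  s_γ := by simp
  α_d := by simp [pullback.condition]
  γ_c := by simp [pullback.condition]

theorem isMul_kernelKite_iff {S : Span C} {p : S.triples ⟶ S.D} :
    S.kernelKite.IsMul p ↔ S.IsMaltsev p := by
  constructor
  · intro hp
    exact
      { triple_left x y h := (hp.lift_left _ _ (by apply pullback.hom_ext <;> simp)).trans (by simp)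
        triple_right y z h :=
          (hp.lift_right _ _ (by apply pullback.hom_ext <;> simp)).trans (by simp)
        comp_d := hp.comp_d.trans (Category.assoc _ _ _).symm
        comp_c := hp.comp_c.trans (Category.assoc _ _ _).symm }
  · intro hp
    exact
      { comp_d := hp.comp_d.trans (Category.assoc _ _ _)
        comp_c := hp.comp_c.trans (Category.assoc _ _ _)
        e₁_comp := (congrArg (· ≫ p) S.e₁_eq_triple).trans (hp.triple_left _ _ _)
        e₂_comp := (congrArg (· ≫ p) S.e₂_eq_triple).trans (hp.triple_right _ _ _) }

/-- The morphism of kernel kites induced by a morphism of spans. -/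
noncomputable def Hom.kernelKiteMap {S T : Span C} (f : Hom S T) :
    DiKite.Hom S.kernelKite T.kernelKite where
  hA := pullback.map S.d S.d T.d T.d f.h f.h f.h₀ f.w_d.symm f.w_d.symm
  hB := f.h
  hC := pullback.map S.c S.c T.c T.c f.h f.h f.h₁ f.w_c.symm f.w_c.symm
  hom := f
  w_f := pullback.lift_snd _ _ _
  w_r := by apply pullback.hom_ext <;> simp
  w_g := pullback.lift_fst _ _ _
  w_s := by apply pullback.hom_ext <;> simp
  w_α := pullback.lift_fst _ _ _
  w_β := (Category.comp_id _).trans (Category.id_comp _).symm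
  w_γ := pullback.lift_snd _ _ _

variable (C) in
/-- The functor sending a span to its kernel kite. -/
noncomputable def kernelKiteFunctor : Span C ⥤ DiKite C where
  obj := kernelKite
  map := Hom.kernelKiteMap
  map_id _ := DiKite.Hom.ext pullback.map_id rfl pullback.map_id rfl
  map_comp f g := DiKite.Hom.ext
    (pullback.map_comp f.h g.h f.h g.h f.h₀ g.h₀ f.w_d.symm f.w_d.symm g.w_d.symm g.w_d.symm).symm
    rfl
    (pullback.map_comp f.h g.h f.h g.h f.h₁ g.h₁ f.w_c.symm f.w_c.symm g.w_c.symm g.w_c.symm).symm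
    rfl

end Span

/-- A pregroupoid is a span with a multiplication on its kernel kite. -/
noncomputable def PreGrpd.forgetsMul :
    ForgetsMul (PreGrpd.forget C) (Span.kernelKiteFunctor C) where
  mul X := X.p
  isMul X := ⟨X.p_d, X.p_c, X.e₁_p, X.e₂_p⟩
  faithful := ⟨PreGrpd.Hom.ext⟩
  exists_map_eq_iff _ := ⟨fun ⟨φ, hφ⟩ => hφ ▸ φ.w_p, fun hf => ⟨⟨_, hf⟩, rfl⟩⟩
  ofMul S p hp := ⟨S, p, hp.e₁_comp, hp.e₂_comp, hp.comp_d, hp.comp_c⟩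
  obj_ofMul _ _ _ := rfl
  ofMul_mul _ := rfl

/-! ### Unital multiplications on reflexive graphs -/

namespace RG

/-- A reducible form of `RG.toSpan`. -/
abbrev span (R : RG C) : Span C where
  D := R.C₁
  D₀ := R.C₀
  D₁ := R.C₀
  d := R.d
  c := R.c
  hasKernelPair_d := inferInstance
  hasKernelPair_c := inferInstance

/-- The directed kite `C₁ ⇄ C₀ ⇄ C₁` of a reflexive graph, in which `d` is split by `e` on the left
and `c` is split by `e` on the right. Its multiplications are the unital multiplications on the
graph. -/
abbrev kite (R : RG C) : DiKite C where
  A := R.C₁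
  B := R.C₀
  C' := R.C₁
  span := R.span
  f := R.d
  r := R.e
  g := R.c
  s := R.e
  α := 𝟙 R.C₁
  β := R.e
  γ := 𝟙 R.C₁
  r_f := R.e_d
  s_g := R.e_c
  r_α := Category.comp_id _
  s_γ := Category.comp_id _
  α_d := by simp [R.e_d]
  γ_c := by simp [R.e_c]

variable (C) in
/-- The functor sending a reflexive graph to its directed kite. -/
def kiteFunctor : RG C ⥤ DiKite C where
  obj := kite
  map f :=
    { hA := f.f₁
      hB := f.f₀
      hC := f.f₁
      hom := (spanFunctor C).map f
      w_f := f.w_d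
      w_r := f.w_e.symm
      w_g := f.w_c
      w_s := f.w_e.symm
      w_α := (Category.comp_id _).trans (Category.id_comp _).symm
      w_β := f.w_e.symm
      w_γ := (Category.comp_id _).trans (Category.id_comp _).symm }

end RG

/-- A unital multiplicative graph is a reflexive graph with a multiplication on its kite. -/
def UMG.forgetsMul : ForgetsMul (UMG.forget C) (RG.kiteFunctor C) where
  mul X := X.m
  isMul X :=
    { comp_d := X.m_d.trans (congrArg _ (Category.id_comp _).symm)
      comp_c := X.m_c.trans (congrArg _ (Category.id_comp _).symm)
      e₁_comp := X.e₁_m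
      e₂_comp := X.e₂_m }
  faithful := ⟨UMG.Hom.ext⟩
  exists_map_eq_iff _ := ⟨fun ⟨φ, hφ⟩ => hφ ▸ φ.w_m, fun hf => ⟨⟨_, hf⟩, rfl⟩⟩
  ofMul R m hm :=
    { graph := R
      m := m
      m_d := hm.comp_d.trans (congrArg _ (Category.id_comp _))
      m_c := hm.comp_c.trans (congrArg _ (Category.id_comp _))
      e₁_m := hm.e₁_comp
      e₂_m := hm.e₂_comp }
  obj_ofMul _ _ _ := rfl
  ofMul_mul _ := rfl

/-! ### The kernel graph of a span -/

namespace Span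

variable (C) in
/-- The kernel pair construction as a functor to reflexive graphs. -/
noncomputable def kernelGraphFunctor : Span C ⥤ RG C where
  obj := kernelGraph
  map f :=
    { f₁ := Hom.triplesMap f
      f₀ := f.h
      w_d := Hom.triplesMap_dom f
      w_c := Hom.triplesMap_cod f
      w_e := by simp [kernelGraph, diag_eq_triple] }
  map_id S := RG.Hom.ext (triplesMap_id S) rfl
  map_comp f g := RG.Hom.ext (triplesMap_comp f g) rfl

instance (S : Span C) : HasPullback S.dom S.cod :=
  inferInstanceAs (HasPullback S.kernelGraph.d S.kernelGraph.c)

/-- `(x, y, z) ↦ ((y, x, x), (z, z, y))`, a composable pair in the kernel graph. -/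
noncomputable def toComposable (S : Span C) : S.triples ⟶ pullback S.dom S.cod :=
  pullback.lift (S.triple S.mid S.dom S.dom S.dom_d.symm rfl)
    (S.triple S.cod S.cod S.mid rfl S.mid_c.symm) (by simp)

theorem triple_toComposable (S : Span C) {Z : C} (x y z : Z ⟶ S.D) (h : x ≫ S.d = y ≫ S.d)
    (h' : y ≫ S.c = z ≫ S.c) : S.triple x y z h h' ≫ S.toComposable =
      pullback.lift (S.triple y x x h.symm rfl) (S.triple z z y rfl h'.symm) (by simp) := by
  apply pullback.hom_ext <;> simp [toComposable]

theorem isMaltsev_of_isMul_kernelGraph {S : Span C} {m : pullback S.dom S.cod ⟶ S.triples}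
    (hm : S.kernelGraph.kite.IsMul m) : S.IsMaltsev (S.toComposable ≫ m ≫ S.mid) where
  triple_left x y h := by
    have unit : pullback.lift (S.triple y x x h.symm rfl) (S.triple y y y rfl rfl) (by simp) ≫ m =
        S.triple y x x h.symm rfl :=
      (hm.lift_left _ _ (by simp [kernelGraph, diag_eq_triple])).trans (Category.comp_id _)
    rw [← Category.assoc, triple_toComposable, reassoc_of% unit, triple_mid]
  triple_right y z h := by
    have unit : pullback.lift (S.triple y y y rfl rfl) (S.triple z z y rfl h.symm) (by simp) ≫ m =
        S.triple z z y rfl h.symm :=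
      (hm.lift_right _ _ (by simp [kernelGraph, diag_eq_triple])).trans (Category.comp_id _)
    rw [← Category.assoc, triple_toComposable, reassoc_of% unit, triple_mid]
  comp_d := by
    have m_dom : m ≫ S.dom = pullback.snd _ _ ≫ S.dom :=
      hm.comp_d.trans (congrArg _ (Category.id_comp _))
    simp [← dom_d, reassoc_of% m_dom, toComposable, reassoc_of% triple_dom]
  comp_c := by
    have m_cod : m ≫ S.cod = pullback.fst _ _ ≫ S.cod :=
      hm.comp_c.trans (congrArg _ (Category.id_comp _))
    simp [mid_c, reassoc_of% m_cod, toComposable, reassoc_of% triple_cod]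

/-- Natural unital multiplications on kernel graphs give natural Mal'tsev operations, by
multiplying `(y, x, x)` with `(z, z, y)`. -/
noncomputable def naturalMulOfKernelGraph {M : ObjectProperty (Span C)}
    (N : NaturalMul (kernelGraphFunctor C ⋙ RG.kiteFunctor C) M) :
    NaturalMul (kernelKiteFunctor C) M where
  mul S hS := S.toComposable ≫ (N.mul S hS : pullback S.dom S.cod ⟶ S.triples) ≫ S.mid
  isMul S hS := isMul_kernelKite_iff.2 (isMaltsev_of_isMul_kernelGraph (N.isMul S hS))
  preservesMul {S T} hS hT f := by
    let m : pullback S.dom S.cod ⟶ S.triples := N.mul S hS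
    let m' : pullback T.dom T.cod ⟶ T.triples := N.mul T hT
    let f₂ := pullback.map S.dom S.cod T.dom T.cod (Hom.triplesMap f) (Hom.triplesMap f) f.h
      (Hom.triplesMap_dom f).symm (Hom.triplesMap_cod f).symm
    have natural : m ≫ Hom.triplesMap f = f₂ ≫ m' := N.preservesMul hS hT f
    have composable : S.toComposable ≫ f₂ = Hom.triplesMap f ≫ T.toComposable := by
      apply pullback.hom_ext <;> simp [toComposable, f₂]
    calc (S.toComposable ≫ m ≫ S.mid) ≫ f.h = S.toComposable ≫ f₂ ≫ m' ≫ T.mid := by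
          rw [← reassoc_of% natural, Hom.triplesMap_mid, Category.assoc, Category.assoc]
      _ = Hom.triplesMap f ≫ T.toComposable ≫ m' ≫ T.mid := by rw [reassoc_of% composable]

end Span

end

/-! ### The Kite Condition -/

section

variable {C : Type u} [Category.{v} C]

theorem IsLocalProduct.symm {A E B : C} {p₁ : E ⟶ A} {e₁ : A ⟶ E} {p₂ : E ⟶ B} {e₂ : B ⟶ E}
    (h : IsLocalProduct p₁ e₁ p₂ e₂) : IsLocalProduct p₂ e₂ p₁ e₁ := by
  obtain ⟨_, f, r, g, s, hf, hg, hp, h₁₁, h₁₂, h₂₁, h₂₂⟩ := h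
  exact ⟨_, g, s, f, r, hg, hf, hp.flip, h₂₂, h₂₁, h₁₂, h₁₁⟩

/-- The data to which the Kite Condition applies: `T` is the span `(E, p₁, p₂)`, and `S` is the
span `(D, d, c)`. -/
structure Kite (T S : Span C) where
  e₁ : T.D₀ ⟶ T.D
  e₂ : T.D₁ ⟶ T.D
  α : T.D₀ ⟶ S.D
  β : T.D ⟶ S.D
  γ : T.D₁ ⟶ S.D
  e₁_d : e₁ ≫ T.d = 𝟙 T.D₀
  e₂_c : e₂ ≫ T.c = 𝟙 T.D₁
  comm : (T.c ≫ e₂) ≫ T.d ≫ e₁ = (T.d ≫ e₁) ≫ T.c ≫ e₂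
  comp_α : (T.c ≫ e₂ ≫ T.d) ≫ α = β
  comp_γ : (T.d ≫ e₁ ≫ T.c) ≫ γ = β
  α_d : T.d ≫ α ≫ S.d = (T.c ≫ e₂ ≫ T.d) ≫ α ≫ S.d
  γ_c : T.c ≫ γ ≫ S.c = (T.d ≫ e₁ ≫ T.c) ≫ γ ≫ S.c

namespace Kite

variable {T S : Span C} (k : Kite T S)

/-- The conclusion of the Kite Condition for the morphism `m`. -/
def IsFiller (m : T.D ⟶ S.D) : Prop :=
  k.e₁ ≫ m = k.α ∧ k.e₂ ≫ m = k.γ ∧ m ≫ S.d = T.c ≫ k.γ ≫ S.d ∧ m ≫ S.c = T.d ≫ k.α ≫ S.c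

theorem d_α_d : (T.d ≫ k.α) ≫ S.d = k.β ≫ S.d := by
  rw [Category.assoc, k.α_d, ← k.comp_α, Category.assoc _ k.α]

theorem β_c : k.β ≫ S.c = (T.c ≫ k.γ) ≫ S.c := by
  rw [Category.assoc, k.γ_c, ← k.comp_γ, Category.assoc _ k.γ]

end Kite

end

section

variable {C : Type u} [Category.{v} C] [HasLocalProducts C]

attribute [local simp] pullback.lift_fst pullback.lift_snd pullback.lift_fst_assoc
  pullback.lift_snd_assoc

namespace Kite

variable {T S : Span C} (k : Kite T S)

/-- The candidate filler `x ↦ p (α p₁ x, β x, γ p₂ x)` built from a Mal'tsev operation `p`. -/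
noncomputable def fill (p : S.triples ⟶ S.D) : T.D ⟶ S.D :=
  S.triple (T.d ≫ k.α) k.β (T.c ≫ k.γ) k.d_α_d k.β_c ≫ p

variable {p : S.triples ⟶ S.D}

theorem isFiller_fill (hp : S.IsMaltsev p) : k.IsFiller (k.fill p) := by
  have e₁_β : k.e₁ ≫ k.β = k.e₁ ≫ T.c ≫ k.γ := by simp [← k.comp_γ, reassoc_of% k.e₁_d]
  have e₂_β : k.e₂ ≫ k.β = k.e₂ ≫ T.d ≫ k.α := by simp [← k.comp_α, reassoc_of% k.e₂_c]
  refine ⟨?_, ?_, ?_, ?_⟩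
  · simp [fill, ← Category.assoc _ _ p, reassoc_of% k.e₁_d, e₁_β, hp.triple_left]
  · simp [fill, ← Category.assoc _ _ p, reassoc_of% k.e₂_c, e₂_β, hp.triple_right]
  · rw [fill, hp.triple_comp_d, Category.assoc]
  · rw [fill, hp.triple_comp_c, Category.assoc]

/-- A filler reverses direction, so it is a morphism of spans from `T.flip`. -/
def toHom {m : T.D ⟶ S.D} (hm : k.IsFiller m) : Span.Hom T.flip S where
  h := m
  h₀ := k.γ ≫ S.d
  h₁ := k.α ≫ S.c
  w_d := hm.2.2.1
  w_c := hm.2.2.2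

/-- The identity of `T` is `q (e₁ p₁, e₁ p₁ e₂ p₂, e₂ p₂)`, since the legs are jointly monic. A
filler `m` that commutes with the operations is therefore determined by its composites with
`e₁ p₁` and `e₂ p₂`. -/
theorem eq_fill (hT : T.JointlyMonic) {q : T.flip.triples ⟶ T.D} (hq : T.flip.IsMaltsev q)
    {m : T.D ⟶ S.D} (hm : k.IsFiller m) (hmq : q ≫ m = (k.toHom hm).triplesMap ≫ p) :
    m = k.fill p := by
  obtain ⟨e₁_m, e₂_m, -⟩ := id hm
  have hc : (T.d ≫ k.e₁) ≫ T.c = (T.c ≫ k.e₂ ≫ T.d ≫ k.e₁) ≫ T.c := by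
    have := k.comm =≫ T.c
    simp_all [k.e₂_c]
  have hd : (T.c ≫ k.e₂ ≫ T.d ≫ k.e₁) ≫ T.d = (T.c ≫ k.e₂) ≫ T.d := by simp [k.e₁_d]
  have id_eq : T.flip.triple _ _ _ hc hd ≫ q = 𝟙 T.D :=
    hT _ _ ((hq.triple_comp_c _ _ _ _ _).trans (by simp [k.e₁_d]))
      ((hq.triple_comp_d _ _ _ _ _).trans (by simp [k.e₂_c]))
  have key := T.flip.triple _ _ _ hc hd ≫= hmq
  rw [reassoc_of% id_eq, ← Category.assoc, Span.triple_triplesMap] at key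
  simpa [toHom, fill, e₁_m, e₂_m, ← k.comp_α] using key

theorem existsUnique_isFiller (hT : T.JointlyMonic) (hp : S.IsMaltsev p)
    {q : T.flip.triples ⟶ T.D} (hq : T.flip.IsMaltsev q)
    (natural : ∀ f : Span.Hom T.flip S, q ≫ f.h = f.triplesMap ≫ p) : ∃! m, k.IsFiller m :=
  ⟨k.fill p, k.isFiller_fill hp, fun _ hm => k.eq_fill hT hq hm (natural (k.toHom hm))⟩

end Kite

namespace DiKite

variable (X : DiKite C)

/-- The span part of the local product of a directed kite. -/
noncomputable abbrev localSpan : Span C where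
  D := pullback X.f X.g
  D₀ := X.A
  D₁ := X.C'
  d := pullback.fst _ _
  c := pullback.snd _ _
  hasKernelPair_d := HasLocalProducts.hasPullback _ X.e₁ _ X.e₁ (by simp [e₁]) (by simp [e₁])
  hasKernelPair_c := HasLocalProducts.hasPullback _ X.e₂ _ X.e₂ (by simp [e₂]) (by simp [e₂])

theorem isLocalProduct_localSpan :
    IsLocalProduct X.localSpan.d X.e₁ X.localSpan.c X.e₂ :=
  ⟨X.B, X.f, X.r, X.g, X.s, X.r_f, X.s_g, IsPullback.of_hasPullback _ _, by simp [e₁],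
    by simp [e₁], by simp [e₂], by simp [e₂]⟩

theorem jointlyMonic_localSpan : X.localSpan.JointlyMonic := fun _ _ _ => pullback.hom_ext

/-- The kite over the local product of a directed kite. -/
noncomputable def toKite : Kite X.localSpan X.span where
  e₁ := X.e₁
  e₂ := X.e₂
  α := X.α
  β := pullback.fst _ _ ≫ X.f ≫ X.β
  γ := X.γ
  e₁_d := by simp [e₁]
  e₂_c := by simp [e₂]
  comm := by
    apply pullback.hom_ext <;>
      simp [e₁, e₂, pullback.condition_assoc, reassoc_of% X.s_g, reassoc_of% X.r_f]
  comp_α := by simp [e₂, X.r_α, pullback.condition_assoc]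
  comp_γ := by simp [e₁, X.s_γ]
  α_d := by simp [e₂, X.α_d, reassoc_of% X.r_f, pullback.condition_assoc]
  γ_c := by simp [e₁, X.γ_c, reassoc_of% X.s_g, pullback.condition_assoc]

theorem isMul_iff_isFiller {m : pullback X.f X.g ⟶ X.span.D} : X.IsMul m ↔ X.toKite.IsFiller m :=
  ⟨fun h => ⟨h.e₁_comp, h.e₂_comp, h.comp_d, h.comp_c⟩, fun ⟨h₁, h₂, hd, hc⟩ => ⟨hd, hc, h₁, h₂⟩⟩

end DiKite

variable {M : ObjectProperty (Span C)}

theorem NaturalMul.uniqueMul (N : NaturalMul (Span.kernelKiteFunctor C) M)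
    (hL : ContainsLocalProducts M) : UniqueMul M := by
  intro X hX
  have hT : M X.localSpan.flip := hL X.localSpan.flip _ _ X.isLocalProduct_localSpan.symm
  simpa only [X.isMul_iff_isFiller] using
    X.toKite.existsUnique_isFiller X.jointlyMonic_localSpan
      (Span.isMul_kernelKite_iff.1 (N.isMul _ hX)) (Span.isMul_kernelKite_iff.1 (N.isMul _ hT))
      (N.preservesMul hT hX)

theorem UniqueMul.kiteCondition (h : UniqueMul M) : KiteCondition M := by
  intro S T hS hT hj e₁ e₂ α β γ h₁ h₂ hcomm hα hγ hd hc
  obtain ⟨p, hp, -⟩ := h S.kernelKite hS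
  obtain ⟨q, hq, -⟩ := h T.kernelKite hT
  have hq' := (Span.isMul_kernelKite_iff.1 hq).flip
  exact Kite.existsUnique_isFiller ⟨e₁, e₂, α, β, γ, h₁, h₂, hcomm, hα, hγ, hd, hc⟩ hj
    (Span.isMul_kernelKite_iff.1 hp) hq' fun f =>
      h.preservesMul hS (Span.isMul_kernelKite_iff.2 hq') hp f.kernelKiteMap

theorem KiteCondition.uniqueMul (h : KiteCondition M) (hL : ContainsLocalProducts M) :
    UniqueMul M := by
  intro X hX
  simp only [X.isMul_iff_isFiller]
  exact h X.span X.localSpan hX (hL _ _ _ X.isLocalProduct_localSpan) X.jointlyMonic_localSpan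
    _ _ _ _ _ X.toKite.e₁_d X.toKite.e₂_c X.toKite.comm X.toKite.comp_α X.toKite.comp_γ
    X.toKite.α_d X.toKite.γ_c

/-! ### Associativity and inverses -/

namespace RG

instance (R : RG C) : HasPullback (pullback.snd R.d R.c) (pullback.fst R.d R.c) :=
  HasLocalProducts.hasPullback _ R.e₂ _ R.e₁ (by simp [e₂]) (by simp [e₁])

variable (R : RG C) {p : R.span.triples ⟶ R.span.D} (hp : R.span.IsMaltsev p)

/-- The directed kite `D(d) ⇄ C₁ ⇄ D(c)` with left splitting `v ↦ (1, v)`, whose multiplications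
are the operations `(x, v, w) ↦ x v⁻¹ w`. -/
noncomputable abbrev divisionKite : DiKite C where
  A := pullback R.d R.d
  B := R.C₁
  C' := pullback R.c R.c
  span := R.span
  f := pullback.snd _ _
  r := pullback.lift (R.d ≫ R.e) (𝟙 _) (by simp [R.e_d])
  g := pullback.fst _ _
  s := pullback.lift (𝟙 _) (𝟙 _) rfl
  α := pullback.fst _ _
  β := R.d ≫ R.e
  γ := R.span.triple (pullback.fst _ _ ≫ R.d ≫ R.e) (pullback.fst _ _) (pullback.snd _ _)
    (by simp [R.e_d]) pullback.condition ≫ p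
  r_f := by simp
  s_g := by simp
  r_α := by simp
  s_γ := by simp [← Category.assoc _ _ p, hp.triple_left]
  α_d := by simp [R.e_d, pullback.condition]
  γ_c := by simp [hp.triple_comp_c]

theorem isMul_divisionKite : (R.divisionKite hp).IsMul p where
  comp_d := hp.comp_d.trans ((Category.assoc _ _ _).trans (congrArg _ (hp.triple_comp_d ..).symm))
  comp_c := hp.comp_c.trans (Category.assoc _ _ _)
  e₁_comp := (congrArg (· ≫ p) R.span.e₁_eq_triple).trans (hp.triple_left _ _ _)
  e₂_comp := by
    congr 1
    refine Span.triples_ext (S := R.span) ?_ ?_ ?_ <;>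
      simp [DiKite.e₂, Span.dom, Span.mid, Span.cod, Span.p₁, Span.p₂, Span.triple]

end RG

namespace UMG

variable {X : UMG C}

theorem comp_mul {Z W : C} (a : W ⟶ Z) (x y : Z ⟶ X.graph.C₁)
    (h : x ≫ X.graph.d = y ≫ X.graph.c) :
    a ≫ X.mul x y h = X.mul (a ≫ x) (a ≫ y) (by simp [h]) := by
  rw [mul, mul, ← Category.assoc]
  congr 1
  apply pullback.hom_ext <;> simp

theorem lift_m {Z : C} (x y : Z ⟶ X.graph.C₁) (h : x ≫ X.graph.d = y ≫ X.graph.c) :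
    pullback.lift x y h ≫ X.m = X.mul x y h :=
  rfl

theorem mul_eq_left {Z : C} (x : Z ⟶ X.graph.C₁) {y : Z ⟶ X.graph.C₁}
    (h : x ≫ X.graph.d = y ≫ X.graph.c) (hy : y = x ≫ X.graph.d ≫ X.graph.e) :
    X.mul x y h = x :=
  ((forgetsMul.isMul X).lift_left x h hy).trans (Category.comp_id x)

theorem mul_eq_right {Z : C} {x : Z ⟶ X.graph.C₁} (y : Z ⟶ X.graph.C₁)
    (h : x ≫ X.graph.d = y ≫ X.graph.c) (hx : x = y ≫ X.graph.c ≫ X.graph.e) :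
    X.mul x y h = y :=
  ((forgetsMul.isMul X).lift_right y h hx).trans (Category.comp_id y)

theorem mul_fst_snd : X.mul (pullback.fst _ _) (pullback.snd _ _) pullback.condition = X.m := by
  have : pullback.lift (pullback.fst X.graph.d X.graph.c) (pullback.snd _ _) pullback.condition =
      𝟙 _ := by
    apply pullback.hom_ext <;> simp
  rw [mul, this, Category.id_comp]

variable (X) in
/-- The directed kite `C₂ ⇄ C₁ ⇄ C₂` over composable triples of arrows, for which both bracketings
of the product are multiplications. -/
noncomputable abbrev assocKite : DiKite C where
  A := pullback X.graph.d X.graph.c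
  B := X.graph.C₁
  C' := pullback X.graph.d X.graph.c
  span := X.graph.span
  f := pullback.snd _ _
  r := X.graph.e₂
  g := pullback.fst _ _
  s := X.graph.e₁
  α := X.m
  β := 𝟙 _
  γ := X.m
  r_f := by simp [RG.e₂]
  s_g := by simp [RG.e₁]
  r_α := X.e₂_m
  s_γ := X.e₁_m
  α_d := by simp [X.m_d]
  γ_c := by simp [X.m_c]

theorem isMul_mul_left : X.assocKite.IsMul
    (X.mul (pullback.fst X.assocKite.f X.assocKite.g ≫ X.m)
      (pullback.snd X.assocKite.f X.assocKite.g ≫ pullback.snd _ _)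
      (by simp [X.m_d, pullback.condition_assoc, pullback.condition])) where
  comp_d := by simp [mul_d, X.m_d]
  comp_c := by simp [mul_c]
  e₁_comp := by
    rw [comp_mul, mul_eq_left] <;> simp [DiKite.e₁, reassoc_of% X.m_d, RG.e₁]
  e₂_comp := by
    simp [comp_mul, DiKite.e₂, X.e₂_m, mul_fst_snd]

theorem isMul_mul_right : X.assocKite.IsMul
    (X.mul (pullback.fst X.assocKite.f X.assocKite.g ≫ pullback.fst _ _)
      (pullback.snd X.assocKite.f X.assocKite.g ≫ X.m)
      (by simp [X.m_c, pullback.condition, ← pullback.condition_assoc])) where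
  comp_d := by simp [mul_d]
  comp_c := by simp [mul_c, X.m_c]
  e₁_comp := by
    simp [comp_mul, DiKite.e₁, X.e₁_m, mul_fst_snd]
  e₂_comp := by
    rw [comp_mul, mul_eq_right] <;> simp [DiKite.e₂, reassoc_of% X.m_c, RG.e₂]

variable {M : ObjectProperty (Span C)}

theorem isAssociative_of_uniqueMul (h : UniqueMul M) (hX : M X.graph.toSpan) :
    X.IsAssociative := by
  intro Z x y z hxy hyz
  let t : Z ⟶ pullback X.assocKite.f X.assocKite.g :=
    pullback.lift (pullback.lift x y hxy) (pullback.lift y z hyz) (by simp)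
  have := t ≫= (h X.assocKite hX).unique isMul_mul_left isMul_mul_right
  simpa [comp_mul, t, lift_m] using this

theorem dom_d_eq_p₂_γ_c {p : X.graph.span.triples ⟶ X.graph.span.D}
    (hp : X.graph.span.IsMaltsev p) :
    X.graph.span.dom ≫ X.graph.d =
      (X.graph.span.p₂ ≫ (X.graph.divisionKite hp).γ) ≫ X.graph.c := by
  rw [Category.assoc, hp.triple_comp_c, X.graph.span.dom_d, ← X.graph.span.p₂_fst]
  simp [X.graph.e_c]

/-- By uniqueness, `p (x, v, w) = x · p (1, v, w)`, so `p (1, x, 1)` is a right inverse of `x`. -/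
theorem isMul_mul_divisionKite {p : X.graph.span.triples ⟶ X.graph.span.D}
    (hp : X.graph.span.IsMaltsev p) : (X.graph.divisionKite hp).IsMul
      (X.mul X.graph.span.dom (X.graph.span.p₂ ≫ (X.graph.divisionKite hp).γ)
        (dom_d_eq_p₂_γ_c hp)) where
  comp_d := (X.mul_d ..).trans (Category.assoc _ _ _)
  comp_c := (X.mul_c ..).trans (Category.assoc _ _ _)
  e₁_comp := by
    rw [comp_mul, mul_eq_left] <;>
      simp [DiKite.e₁, Span.dom, Span.p₁, Span.p₂, ← Category.assoc _ _ p, hp.triple_left,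
        pullback.condition_assoc]
  e₂_comp := by
    rw [comp_mul, mul_eq_right]
    · simp [DiKite.e₂, Span.p₂, -Span.comp_triple]
    · simp [DiKite.e₂, Span.dom, Span.p₁, Span.p₂, reassoc_of% hp.triple_comp_c,
        reassoc_of% X.graph.e_c]

theorem IsAssociative.hasInverses_of_mul_eq (hX : X.IsAssociative) (i : X.graph.C₁ ⟶ X.graph.C₁)
    (hc : i ≫ X.graph.c = X.graph.d)
    (right : X.mul (𝟙 _) i (by rw [hc, Category.id_comp]) = X.graph.c ≫ X.graph.e) :
    X.HasInverses := by
  have hd : i ≫ X.graph.d = X.graph.c := by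
    rw [← X.mul_d (𝟙 _) i (by rw [hc, Category.id_comp]), right, Category.assoc, X.graph.e_d,
      Category.comp_id]
  have i_right : X.mul i (i ≫ i) (by rw [Category.assoc, hc]) = X.graph.d ≫ X.graph.e := by
    simpa [comp_mul, reassoc_of% hc] using i ≫= right
  have i_i : i ≫ i = 𝟙 _ := by
    have := hX (𝟙 _) i (i ≫ i) (by rw [hc, Category.id_comp]) (by rw [Category.assoc, hc])
    simp only [right, i_right] at this
    rwa [mul_eq_right _ _ (by simp [reassoc_of% hc, reassoc_of% hd]),
      mul_eq_left _ _ (by simp)] at this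
  exact ⟨i, hd, hc, right, by simpa [i_i] using i_right⟩

theorem hasInverses_of_uniqueMul (h : UniqueMul M) (hX : M X.graph.toSpan) : X.HasInverses := by
  obtain ⟨p, hp, -⟩ := h X.graph.span.kernelKite hX
  replace hp := Span.isMul_kernelKite_iff.1 hp
  refine (isAssociative_of_uniqueMul h hX).hasInverses_of_mul_eq
    (X.graph.span.triple (X.graph.d ≫ X.graph.e) (𝟙 _) (X.graph.c ≫ X.graph.e)
      (by simp [X.graph.e_d]) (by simp [X.graph.e_c]) ≫ p)
    ((hp.triple_comp_c ..).trans (by simp [X.graph.e_c])) ?_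
  let t := X.graph.span.triple (𝟙 X.graph.C₁) (𝟙 _) (X.graph.c ≫ X.graph.e) rfl
    (by simp [X.graph.e_c])
  have := t ≫= (h (X.graph.divisionKite hp) hX).unique (X.graph.isMul_divisionKite hp)
    (isMul_mul_divisionKite hp)
  rw [hp.triple_right, comp_mul] at this
  simpa [t, reassoc_of% Span.triple_p₂, ← Category.assoc _ _ p] using this.symm

end UMG

namespace UniqueMul

variable {M : ObjectProperty (Span C)} (h : UniqueMul M)
include h

theorem isIso_mKiteToDiKite : (mKiteToDiKite M).IsIso := MKite.forgetsMul.isIso_restrict h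

theorem isIso_preGrpdToSpan : (preGrpdToSpan M).IsIso := PreGrpd.forgetsMul.isIso_restrict h

theorem isIso_umgToRG : (umgToRG M).IsIso := UMG.forgetsMul.isIso_restrict h

theorem isIso_catToRG : (catToRG M).IsIso :=
  isIso_restrict_ι_comp h.isIso_umgToRG fun _ hX => UMG.isAssociative_of_uniqueMul h hX

theorem isIso_grpdToRG : (grpdToRG M).IsIso :=
  isIso_restrict_ι_comp h.isIso_catToRG fun _ hX => UMG.hasInverses_of_uniqueMul h hX

end UniqueMul

section

variable {M : ObjectProperty (Span C)} (hL : ContainsLocalProducts M)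
include hL

theorem kiteCondition_of_hasSection_preGrpdToSpan (h : HasSection (preGrpdToSpan M)) :
    KiteCondition M :=
  let ⟨N⟩ := PreGrpd.forgetsMul.nonempty_naturalMul h
  (N.uniqueMul hL).kiteCondition

theorem kiteCondition_of_hasSection_mKiteToDiKite (h : HasSection (mKiteToDiKite M)) :
    KiteCondition M :=
  let ⟨N⟩ := MKite.forgetsMul.nonempty_naturalMul h
  ((N.whisker (Span.kernelKiteFunctor C) fun _ hS => hS).uniqueMul hL).kiteCondition

theorem kiteCondition_of_hasSection_umgToRG (hK : ClosedUnderKernelPairs M)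
    (h : HasSection (umgToRG M)) : KiteCondition M :=
  let ⟨N⟩ := UMG.forgetsMul.nonempty_naturalMul h
  ((Span.naturalMulOfKernelGraph (N.whisker _ hK)).uniqueMul hL).kiteCondition

end

end

end RelMaltsev

theorem mainTheorem1 {C : Type u} [Category.{v} C] [RelMaltsev.HasLocalProducts C]
    (M : ObjectProperty (RelMaltsev.Span C))
    (hK : RelMaltsev.ClosedUnderKernelPairs M) (hL : RelMaltsev.ContainsLocalProducts M) :
    List.TFAE
      [RelMaltsev.IsIsoOfCategories (RelMaltsev.grpdToRG M),
       RelMaltsev.HasSection (RelMaltsev.grpdToRG M),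
       RelMaltsev.IsIsoOfCategories (RelMaltsev.catToRG M),
       RelMaltsev.HasSection (RelMaltsev.catToRG M),
       RelMaltsev.IsIsoOfCategories (RelMaltsev.umgToRG M),
       RelMaltsev.HasSection (RelMaltsev.umgToRG M),
       RelMaltsev.IsIsoOfCategories (RelMaltsev.preGrpdToSpan M),
       RelMaltsev.HasSection (RelMaltsev.preGrpdToSpan M),
       RelMaltsev.IsIsoOfCategories (RelMaltsev.mKiteToDiKite M),
       RelMaltsev.HasSection (RelMaltsev.mKiteToDiKite M),
       RelMaltsev.KiteCondition M] := by
  have unique (h : RelMaltsev.KiteCondition M) : RelMaltsev.UniqueMul M := h.uniqueMul hL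
  tfae_have 1 → 2 := RelMaltsev.IsIsoOfCategories.hasSection
  tfae_have 3 → 4 := RelMaltsev.IsIsoOfCategories.hasSection
  tfae_have 5 → 6 := RelMaltsev.IsIsoOfCategories.hasSection
  tfae_have 7 → 8 := RelMaltsev.IsIsoOfCategories.hasSection
  tfae_have 9 → 10 := RelMaltsev.IsIsoOfCategories.hasSection
  tfae_have 2 → 4 := RelMaltsev.HasSection.of_restrict_ι_comp
  tfae_have 4 → 6 := RelMaltsev.HasSection.of_restrict_ι_comp
  tfae_have 6 → 11 := RelMaltsev.kiteCondition_of_hasSection_umgToRG hL hK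
  tfae_have 8 → 11 := RelMaltsev.kiteCondition_of_hasSection_preGrpdToSpan hL
  tfae_have 10 → 11 := RelMaltsev.kiteCondition_of_hasSection_mKiteToDiKite hL
  tfae_have 11 → 1 := fun h => RelMaltsev.isIsoOfCategories_of_isIso (unique h).isIso_grpdToRG
  tfae_have 11 → 3 := fun h => RelMaltsev.isIsoOfCategories_of_isIso (unique h).isIso_catToRG
  tfae_have 11 → 5 := fun h => RelMaltsev.isIsoOfCategories_of_isIso (unique h).isIso_umgToRG
  tfae_have 11 → 7 := fun h => RelMaltsev.isIsoOfCategories_of_isIso (unique h).isIso_preGrpdToSpan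
  tfae_have 11 → 9 := fun h => RelMaltsev.isIsoOfCategories_of_isIso (unique h).isIso_mKiteToDiKite
  tfae_finish
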